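/- Corollary 2.10 (Tetrad representation theorem). Let $G$ be a finite directed acyclic graph with vertex set $V$. A matrix $\Sigma=(\sigma_{ab})_{a,b\in V}$ is called a covariance matrix consistent with $G$ if there are real regression coefficients $\lambda_{ab}$ (one for each edge $a\to b$ of $G$), variances $\phi_v>0$ ($v\in V$), and random variables $X_v,\varepsilon_v$ ($v\in V$) on a common probability space such that the $\varepsilon_v$ are independent with $\varepsilon_v\sim\mathcal N(0,\phi_v)$, $$X_b=\sum_{a:\ a\to b}\lambda_{ab}X_a+\varepsilon_b\qquad(b\in V),$$ and $\sigma_{ab}=\operatorname{Cov}(X_a,X_b)$ for all $a,b\in V$. A trek from $a$ to $b$ is an ordered pair $(P_1,P_2)$ of directed paths in $G$ with a common source, where $P_1$ has sink $a$ and $P_2$ has sink $b$; either path may consist of a single vertex. For $A,B,C_A,C_B\subseteq V$, not necessarily disjoint, the pair $(C_A,C_B)$ t-separates $A$ from $B$ if for every trek $(P_1,P_2)$ from a vertex of $A$ to a vertex of $B$, either $P_1$ contains a vertex of $C_A$ or $P_2$ contains a vertex of $C_B$. Let $i,j,k,l\in V$ (not necessarily distinct). Then $$\sigma_{ik}\sigma_{jl}-\sigma_{il}\sigma_{jk}=0$$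 for all covariance matrices $\Sigma$ consistent with $G$ if and only if there is a node $c\in V$ such that $(\{c\},\varnothing)$ or $(\varnothing,\{c\})$ t-separates $\{i,j\}$ from $\{k,l\}$. -/

import Mathlib

open MeasureTheory ProbabilityTheory
open scoped NNReal

namespace TrekSep

universe u

/-- A digraph is acyclic if no vertex can be reached from itself along one or more edges
(in particular there are no loops). -/
def IsAcyclic {V : Type u} (G : Digraph V) : Prop :=
  ∀ v : V, ¬ Relation.TransGen G.Adj v v

/-- The parents of `j`: the nodes `i` with an edge `i → j`. -/
noncomputable def parents {V : Type u} [Fintype V] (G : Digraph V) (j : V) : Finset V :=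
  open Classical in Finset.univ.filter (fun i => G.Adj i j)

/-- The random variables `X v` satisfy the recursive linear regressions of `G` with regression
coefficients `coef i j` on the edges `i → j`, error variances `φ v > 0` and independent errors
`ε v ∼ 𝒩(0, φ v)`. (Values `coef i j` at non-edges `(i, j)` play no role.) -/
structure IsRegressionSystem {V : Type u} [Fintype V] (G : Digraph V)
    (coef : V → V → ℝ) (φ : V → ℝ≥0)
    {Ω : Type u} [MeasurableSpace Ω] (P : Measure Ω) (X ε : V → Ω → ℝ) : Prop where
  variance_pos : ∀ v, 0 < φ v
  error_law : ∀ v, HasLaw (ε v) (gaussianReal 0 (φ v)) P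
  error_indep : iIndepFun ε P
  regression : ∀ j ω, X j ω = (∑ i ∈ parents G j, coef i j * X i ω) + ε j ω

/-- `S` is a covariance matrix consistent with `G`: it is the covariance matrix of a random
vector satisfying the recursive linear regressions of `G`, for some choice of the regression
coefficients and of the positive error variances. -/
def IsConsistent {V : Type u} [Fintype V] (G : Digraph V) (S : Matrix V V ℝ) : Prop :=
  ∃ (coef : V → V → ℝ) (φ : V → ℝ≥0)
    (Ω : Type u) (_ : MeasurableSpace Ω) (P : Measure Ω) (X ε : V → Ω → ℝ),
    IsProbabilityMeasure P ∧ IsRegressionSystem G coef φ P X ε ∧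
      ∀ a b, S a b = cov[X a, X b; P]

/-- The list of vertices `p` is a directed path in `G` with source `s` and sink `t`. A path may
consist of a single vertex. (In an acyclic digraph the vertices of such a list are automatically
pairwise distinct.) -/
def IsDirectedPath {V : Type u} (G : Digraph V) (p : List V) (s t : V) : Prop :=
  p.IsChain G.Adj ∧ p.head? = some s ∧ p.getLast? = some t

/-- `(p₁, p₂)` is a trek from `i` to `j`: a pair of directed paths with a common source (the top)
such that `p₁` has sink `i` and `p₂` has sink `j`. -/
def IsTrek {V : Type u} (G : Digraph V) (p₁ p₂ : List V) (i j : V) : Prop :=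
  ∃ top : V, IsDirectedPath G p₁ top i ∧ IsDirectedPath G p₂ top j

/-- The pair `(CA, CB)` t-separates `A` from `B`: for every trek `(p₁, p₂)` from a vertex of `A`
to a vertex of `B`, either `p₁` contains a vertex of `CA` or `p₂` contains a vertex of `CB`. -/
def TSeparates {V : Type u} (G : Digraph V) (CA CB A B : Set V) : Prop :=
  ∀ a ∈ A, ∀ b ∈ B, ∀ p₁ p₂ : List V, IsTrek G p₁ p₂ a b →
    (∃ c ∈ CA, c ∈ p₁) ∨ (∃ c ∈ CB, c ∈ p₂)

end TrekSep

/-! With M = (1 - Λ)⁻¹, the entry M s a sums the weights of the directed paths from s to a, and σ_ab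
= ∑ₛ φₛ · M s a · M s b. If ({c}, ∅) separates, then M s a = M s c · M c a for every source s
contributing to σ_ab, so σ_ab = M c a · σ_cb: rows i and j are multiples of one row
(`trekMatrix_eq_mul`).

Conversely, treks are walks from the first to the second copy of V in a doubled graph. Its vertices
receive plane vectors: basis vectors at the copies of k and l, elsewhere combinations of the
successors' vectors, generic enough that two vectors are parallel only if a single vertex meets all
walks from both to the targets (`exists_generic_weights`, a linear-algebra form of Menger's theorem
for two paths). If nothing separates, the vectors of i and j are independent, and Cauchy–Binet gives
sources s, t whose path minors on i, j and on k, l are both nonzero. The two minors may use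
different coefficients; a polynomial argument finds one Λ for both (`exists_minor_ne_zero`).
Variances concentrated near s and t then bring the tetrad close to the product of the minors. -/

namespace TrekSep

/-! ### Generic plane vectors on an acyclic digraph -/

section Generic

/-- `ReachAvoiding H B c u`: some walk of `H` leads from `u` to `B` without meeting `c`. -/
inductive ReachAvoiding {W : Type*} (H : W → W → Prop) (B : Set W) (c : W) : W → Prop
  | base {b : W} : b ∈ B → b ≠ c → ReachAvoiding H B c b
  | step {u w : W} : u ≠ c → H u w → ReachAvoiding H B c w → ReachAvoiding H B c u

/-- The determinant of two plane vectors. -/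
def planeDet (p q : ℝ × ℝ) : ℝ := p.1 * q.2 - p.2 * q.1

lemma planeDet_swap (p q : ℝ × ℝ) : planeDet q p = -planeDet p q := by
  simp only [planeDet]; ring

lemma planeDet_add_smul (p q v : ℝ × ℝ) (x : ℝ) :
    planeDet (p + x • q) v = planeDet p v + x * planeDet q v := by
  simp only [planeDet, Prod.fst_add, Prod.snd_add, Prod.smul_fst, Prod.smul_snd, smul_eq_mul]
  ring

lemma eq_zero_of_planeDet_eq_zero {p q v : ℝ × ℝ} (h : planeDet p q ≠ 0)
    (hp : planeDet p v = 0) (hq : planeDet q v = 0) : v = 0 := by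
  simp only [planeDet] at *
  ext
  · apply (mul_eq_zero.1 (_ : (p.1 * q.2 - p.2 * q.1) * v.1 = 0)).resolve_left h
    linear_combination q.1 * hp - p.1 * hq
  · apply (mul_eq_zero.1 (_ : (p.1 * q.2 - p.2 * q.1) * v.2 = 0)).resolve_left h
    linear_combination q.2 * hp - p.2 * hq

/-- A combination of two independent plane vectors that avoids finitely many lines. -/
lemma exists_planeDet_ne_zero {W : Type*} (S : Finset W) (r : W → ℝ × ℝ) {p q : ℝ × ℝ}
    (h : planeDet p q ≠ 0) :
    ∃ x : ℝ, ∀ v ∈ S, planeDet (p + x • q) (r v) = 0 → r v = 0 := by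
  classical
  -- The determinant against `r v` is affine in x; its root is excluded. Where the slope is 0 the
  -- quotient is 0, a harmless extra exclusion.
  obtain ⟨x, hx⟩ := Infinite.exists_notMem_finset
    (S.image fun v => -planeDet p (r v) / planeDet q (r v))
  refine ⟨x, fun v hv h0 => ?_⟩
  rw [planeDet_add_smul] at h0
  by_cases hq : planeDet q (r v) = 0
  · exact eq_zero_of_planeDet_eq_zero h (by simpa [hq] using h0) hq
  · refine absurd (Finset.mem_image.2 ⟨v, hv, ?_⟩) hx
    rw [div_eq_iff hq]
    linarith

/-- Plane vectors `r` attached to the vertices of `S`, each a combination of the vectors of its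
successors (except at `b₁` and `b₂`), which are parallel only for vertices with the same common
vertex `d` on their walks to `{b₁, b₂}`. -/
structure IsGenericOn {W : Type*} [Fintype W] (H : W → W → Prop) (b₁ b₂ : W) (S : Finset W)
    (r : W → ℝ × ℝ) (d : W → W) : Prop where
  fst : r b₁ = (1, 0)
  snd : r b₂ = (0, 1)
  comb : ∀ u ∈ S, u ≠ b₁ → u ≠ b₂ →
    ∃ w : W → ℝ, (∀ v, w v ≠ 0 → H u v) ∧ r u = ∑ v, w v • r v
  dom : ∀ u ∈ S, ¬ ReachAvoiding H {b₁, b₂} (d u) u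
  zero : ∀ u ∈ S, r u = 0 → ∀ c, ¬ ReachAvoiding H {b₁, b₂} c u
  indep : ∀ u ∈ S, ∀ v ∈ S, planeDet (r u) (r v) = 0 → r u = 0 ∨ r v = 0 ∨ d u = d v

variable {W : Type*} [Fintype W] {H : W → W → Prop} {b₁ b₂ : W}

/-- No old vertex whose vector must be a combination has an edge to `u`, so changing `r` at `u`
leaves all earlier combinations intact. -/
lemma IsGenericOn.insert [DecidableEq W] {S : Finset W} {r : W → ℝ × ℝ} {d : W → W}
    (h : IsGenericOn H b₁ b₂ S r d) (hb₁ : b₁ ∈ S) (hb₂ : b₂ ∈ S) {u : W} (hu : u ∉ S)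
    (hS : ∀ a ∈ S, a ≠ b₁ → a ≠ b₂ → ¬ H a u) (hloop : ¬ H u u) (p : ℝ × ℝ) (e : W)
    (hcomb : ∃ w : W → ℝ, (∀ v, w v ≠ 0 → H u v) ∧ p = ∑ v, w v • r v)
    (hdom : ¬ ReachAvoiding H {b₁, b₂} e u)
    (hzero : p = 0 → ∀ c, ¬ ReachAvoiding H {b₁, b₂} c u)
    (hindep : ∀ v ∈ S, planeDet p (r v) = 0 → p = 0 ∨ r v = 0 ∨ e = d v) :
    IsGenericOn H b₁ b₂ (insert u S) (Function.update r u p) (Function.update d u e) := by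
  have ne : ∀ a ∈ S, a ≠ u := fun a ha hau => hu (hau ▸ ha)
  have sum_eq : ∀ w : W → ℝ, w u = 0 →
      ∑ v, w v • Function.update r u p v = ∑ v, w v • r v := by
    intro w hw
    refine Finset.sum_congr rfl fun v _ => ?_
    by_cases hv : v = u
    · subst hv; simp [hw]
    · rw [Function.update_of_ne hv]
  refine ⟨?_, ?_, ?_, ?_, ?_, ?_⟩
  · rw [Function.update_of_ne (ne _ hb₁), h.fst]
  · rw [Function.update_of_ne (ne _ hb₂), h.snd]
  · intro a ha ha₁ ha₂
    rcases Finset.mem_insert.1 ha with rfl | ha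
    · obtain ⟨w, hw, hp⟩ := hcomb
      refine ⟨w, hw, ?_⟩
      rw [sum_eq w (by by_contra h0; exact hloop (hw _ h0)), Function.update_self, hp]
    · obtain ⟨w, hw, hp⟩ := h.comb a ha ha₁ ha₂
      refine ⟨w, hw, ?_⟩
      rw [sum_eq w (by by_contra h0; exact hS a ha ha₁ ha₂ (hw _ h0)),
        Function.update_of_ne (ne a ha), hp]
  · intro a ha
    rcases Finset.mem_insert.1 ha with rfl | ha
    · rwa [Function.update_self]
    · rw [Function.update_of_ne (ne a ha)]; exact h.dom a ha
  · intro a ha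
    rcases Finset.mem_insert.1 ha with rfl | ha
    · rwa [Function.update_self]
    · rw [Function.update_of_ne (ne a ha)]; exact h.zero a ha
  · intro a ha v hv
    rcases Finset.mem_insert.1 ha with rfl | ha' <;> rcases Finset.mem_insert.1 hv with rfl | hv'
    · intro _; exact Or.inr (Or.inr rfl)
    · rw [Function.update_self, Function.update_self, Function.update_of_ne (ne v hv'),
        Function.update_of_ne (ne v hv')]
      exact hindep v hv'
    · rw [Function.update_self, Function.update_self, Function.update_of_ne (ne a ha'),
        Function.update_of_ne (ne a ha'), planeDet_swap, neg_eq_zero]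
      intro h0
      rcases hindep a ha' h0 with h1 | h1 | h1
      exacts [Or.inr (Or.inl h1), Or.inl h1, Or.inr (Or.inr h1.symm)]
    · rw [Function.update_of_ne (ne a ha'), Function.update_of_ne (ne a ha'),
        Function.update_of_ne (ne v hv'), Function.update_of_ne (ne v hv')]
      exact h.indep a ha' v hv'

/-- Vertices are added in order of increasing rank, successors first; the vector of a new vertex
depends on how many distinct values `d` takes on its successors with nonzero vectors: none, one or
several. -/
lemma exists_isGenericOn [DecidableEq W] (rk : W → ℤ) (hrk : ∀ u v, H u v → rk v < rk u)
    (hb : b₁ ≠ b₂) (S : Finset W) (hb₁ : b₁ ∈ S) (hb₂ : b₂ ∈ S)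
    (hS : ∀ u ∈ S, u ≠ b₁ → u ≠ b₂ → ∀ v, H u v → v ∈ S) :
    ∃ r d, IsGenericOn H b₁ b₂ S r d := by
  induction S using Finset.strongInduction with
  | H S ih =>
  by_cases hT : (S \ {b₁, b₂}).Nonempty
  swap
  · have hS' : ∀ u ∈ S, u = b₁ ∨ u = b₂ := by
      intro u hu
      by_contra hne
      exact hT ⟨u, by simp_all⟩
    refine ⟨fun u => if u = b₁ then (1, 0) else (0, 1), id, ?_, ?_, ?_, ?_, ?_, ?_⟩
    · simp
    · simp [hb.symm]
    · intro u hu h1 h2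
      rcases hS' u hu with h | h <;> contradiction
    · intro u _ h
      cases h with
      | base _ h => exact h rfl
      | step h _ _ => exact h rfl
    · intro u _ h
      by_cases hu : u = b₁ <;> simp [hu] at h
    · intro u hu v hv h
      rcases hS' u hu with rfl | rfl <;> rcases hS' v hv with rfl | rfl <;>
        simp [planeDet, hb.symm] at h ⊢
  obtain ⟨u, hu, hmax⟩ := Finset.exists_max_image _ rk hT
  simp only [Finset.mem_sdiff, Finset.mem_insert, Finset.mem_singleton, not_or] at hu hmax
  obtain ⟨huS, hu₁, hu₂⟩ := hu
  have hnot : ∀ a ∈ S, a ≠ b₁ → a ≠ b₂ → ¬ H a u := fun a ha h1 h2 hau =>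
    (hrk _ _ hau).not_ge (hmax a ⟨ha, h1, h2⟩)
  have hb₁' : b₁ ∈ S.erase u := Finset.mem_erase.2 ⟨Ne.symm hu₁, hb₁⟩
  have hb₂' : b₂ ∈ S.erase u := Finset.mem_erase.2 ⟨Ne.symm hu₂, hb₂⟩
  obtain ⟨r, d, h⟩ := ih (S.erase u) (Finset.erase_ssubset huS) hb₁' hb₂' (by
    intro a ha h1 h2 v hv
    refine Finset.mem_erase.2 ⟨?_, hS a (Finset.mem_of_mem_erase ha) h1 h2 v hv⟩
    rintro rfl
    exact hnot a (Finset.mem_of_mem_erase ha) h1 h2 hv)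
  have hloop : ¬ H u u := fun h => lt_irrefl _ (hrk _ _ h)
  have hchild : ∀ v, H u v → v ∈ S.erase u := fun v hv =>
    Finset.mem_erase.2 ⟨by rintro rfl; exact hloop hv, hS u huS hu₁ hu₂ v hv⟩
  have hinv : ∀ c, ReachAvoiding H {b₁, b₂} c u → u ≠ c ∧
      ∃ v, H u v ∧ ReachAvoiding H {b₁, b₂} c v := by
    intro c hc
    cases hc with
    | base hm _ => rcases hm with rfl | rfl <;> contradiction
    | step hne hv hr => exact ⟨hne, _, hv, hr⟩
  have key := h.insert hb₁' hb₂' (Finset.notMem_erase u S)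
    (fun a ha => hnot a (Finset.mem_of_mem_erase ha)) hloop
  rw [Finset.insert_erase huS] at key
  by_cases h0 : ∀ v, H u v → r v = 0
  · have hno : ∀ c, ¬ ReachAvoiding H {b₁, b₂} c u := by
      intro c hc
      obtain ⟨_, v, hv, hr⟩ := hinv c hc
      exact h.zero v (hchild v hv) (h0 v hv) c hr
    exact ⟨_, _, key 0 u ⟨0, by simp, by simp⟩ (hno u) (fun _ => hno) (fun _ _ _ => Or.inl rfl)⟩
  push Not at h0
  obtain ⟨v₀, hv₀, hr₀⟩ := h0
  have hsingle : ∀ v, H u v → ∀ x : ℝ, ∀ a, (Pi.single v x : W → ℝ) a ≠ 0 → H u a := by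
    intro v hv x a ha
    by_cases hav : a = v
    · exact hav ▸ hv
    · exact absurd (Pi.single_eq_of_ne (M := fun _ => ℝ) hav x) ha
  have hsum : ∀ v (x : ℝ), ∑ a, (Pi.single v x : W → ℝ) a • r a = x • r v := by
    intro v x
    rw [Finset.sum_eq_single v]
    · simp
    · intro a _ ha; simp [ha]
    · simp
  -- One common `d v₀`: it also meets every walk from `u`, so `u` copies the vector and the label of
  -- `v₀`.
  by_cases h1 : ∀ v, H u v → r v ≠ 0 → d v = d v₀
  · refine ⟨_, _, key (r v₀) (d v₀) ⟨Pi.single v₀ 1, hsingle _ hv₀ _, by simp [hsum]⟩ ?_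
      (fun h => absurd h hr₀) (h.indep v₀ (hchild _ hv₀))⟩
    intro hc
    obtain ⟨_, v, hv, hr⟩ := hinv _ hc
    by_cases hrv : r v = 0
    · exact h.zero v (hchild v hv) hrv _ hr
    · exact h.dom v (hchild v hv) (h1 v hv hrv ▸ hr)
  push Not at h1
  obtain ⟨v₁, hv₁, hr₁, hd⟩ := h1
  have hdet : planeDet (r v₁) (r v₀) ≠ 0 := by
    intro h0
    rcases h.indep v₁ (hchild _ hv₁) v₀ (hchild _ hv₀) h0 with h | h | h
    exacts [hr₁ h, hr₀ h, hd h]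
  -- Two labels: the successors span the plane, so `u` becomes its own label with a vector parallel
  -- to no earlier nonzero one.
  obtain ⟨x, hx⟩ := exists_planeDet_ne_zero (S.erase u) r hdet
  refine ⟨_, _, key (r v₁ + x • r v₀) u ⟨Pi.single v₁ 1 + Pi.single v₀ x, ?_, ?_⟩ ?_ ?_ ?_⟩
  · intro a ha
    by_contra hna
    refine ha ?_
    rw [Pi.add_apply, not_not.1 (mt (hsingle v₁ hv₁ 1 a) hna),
      not_not.1 (mt (hsingle v₀ hv₀ x a) hna), add_zero]
  · simp only [Pi.add_apply, add_smul, Finset.sum_add_distrib, hsum, one_smul]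
  · intro hc
    exact (hinv _ hc).1 rfl
  · intro hp
    refine absurd ?_ hr₀
    exact hx v₀ (hchild _ hv₀) (by rw [hp]; simp [planeDet])
  · intro v hv hp
    exact Or.inr (Or.inl (hx v hv hp))

/-- Generic edge weights on a finite acyclic digraph: if no vertex meets all walks from `u` and `v`
to `{b₁, b₂}`, then the plane vectors of `u` and `v` are independent. -/
theorem exists_generic_weights (rk : W → ℤ) (hrk : ∀ u v, H u v → rk v < rk u)
    (hb : b₁ ≠ b₂) :
    ∃ (w : W → W → ℝ) (r : W → ℝ × ℝ), (∀ u v, w u v ≠ 0 → H u v) ∧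
      r b₁ = (1, 0) ∧ r b₂ = (0, 1) ∧ (∀ v, w b₁ v = 0) ∧ (∀ v, w b₂ v = 0) ∧
      (∀ u, u ≠ b₁ → u ≠ b₂ → r u = ∑ v, w u v • r v) ∧
      ∀ u v, planeDet (r u) (r v) = 0 →
        ∃ c, ¬ ReachAvoiding H {b₁, b₂} c u ∧ ¬ ReachAvoiding H {b₁, b₂} c v := by
  classical
  obtain ⟨r, d, h⟩ := exists_isGenericOn (H := H) rk hrk hb Finset.univ (Finset.mem_univ _)
    (Finset.mem_univ _) (fun _ _ _ _ _ _ => Finset.mem_univ _)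
  have hw : ∀ u, ∃ w : W → ℝ, (∀ v, w v ≠ 0 → H u v) ∧ (u = b₁ ∨ u = b₂ → ∀ v, w v = 0) ∧
      (u ≠ b₁ → u ≠ b₂ → r u = ∑ v, w v • r v) := by
    intro u
    by_cases hu : u = b₁ ∨ u = b₂
    · exact ⟨0, by simp, by simp, fun h1 h2 => absurd hu (by tauto)⟩
    · push Not at hu
      obtain ⟨w, hw, hr⟩ := h.comb u (Finset.mem_univ _) hu.1 hu.2
      exact ⟨w, hw, fun h => absurd h (by tauto), fun _ _ => hr⟩
  choose w hw1 hw2 hw3 using hw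
  refine ⟨w, r, hw1, h.fst, h.snd, hw2 _ (Or.inl rfl), hw2 _ (Or.inr rfl), hw3, ?_⟩
  intro u v h0
  rcases h.indep u (Finset.mem_univ _) v (Finset.mem_univ _) h0 with h1 | h1 | h1
  · exact ⟨d v, h.zero u (Finset.mem_univ _) h1 _, h.dom v (Finset.mem_univ _)⟩
  · exact ⟨d u, h.dom u (Finset.mem_univ _), h.zero v (Finset.mem_univ _) h1 _⟩
  · exact ⟨d u, h.dom u (Finset.mem_univ _), h1 ▸ h.dom v (Finset.mem_univ _)⟩

end Generic

/-! ### Ranks and directed paths -/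

section Paths

lemma exists_rank {V : Type*} [Fintype V] {G : Digraph V} (hG : IsAcyclic G) :
    ∃ ρ : V → ℕ, ∀ a b, G.Adj a b → ρ a < ρ b := by
  classical
  refine ⟨fun v => (Finset.univ.filter fun a => Relation.TransGen G.Adj a v).card,
    fun a b hab => Finset.card_lt_card (Finset.ssubset_iff_of_subset ?_ |>.2 ⟨a, ?_, ?_⟩)⟩
  · intro c hc
    simp only [Finset.mem_filter, Finset.mem_univ, true_and] at hc ⊢
    exact hc.tail hab
  · simpa using Relation.TransGen.single hab
  · simpa using hG a

variable {V : Type*} {G : Digraph V}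

lemma isDirectedPath_singleton (s : V) : IsDirectedPath G [s] s s := by
  simp [IsDirectedPath]

lemma IsDirectedPath.append_singleton {p : List V} {s a b : V} (hp : IsDirectedPath G p s a)
    (hab : G.Adj a b) : IsDirectedPath G (p ++ [b]) s b := by
  obtain ⟨h1, h2, h3⟩ := hp
  refine ⟨?_, ?_, ?_⟩
  · rw [List.isChain_append]
    refine ⟨h1, by simp, ?_⟩
    intro x hx y hy
    simp_all
  · rw [List.head?_append, h2]; rfl
  · simp

lemma TSeparates.symm {CA CB A B : Set V} (h : TSeparates G CA CB A B) :
    TSeparates G CB CA B A := by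
  rintro b hb a ha p q ⟨s, hp, hq⟩
  exact (h a ha b hb q p ⟨s, hq, hp⟩).symm

end Paths

/-! ### Path matrices, trek matrices and their minors -/

section PathMatrix

variable {V : Type*} [Fintype V] [DecidableEq V]

/-- The matrix `(1 - Λ)⁻¹`, whose entry at `(s, b)` is the sum of the weights of the directed paths
from `s` to `b`. -/
noncomputable def pathMatrix (Λ : Matrix V V ℝ) : Matrix V V ℝ := (1 - Λ)⁻¹

variable {Λ : Matrix V V ℝ} {ρ : V → ℕ}

/-- A solution of x = xΛ vanishes by induction on rank, since each entry involves only entries of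
smaller rank. -/
lemma isUnit_one_sub (hΛ : ∀ a b, Λ a b ≠ 0 → ρ a < ρ b) : IsUnit (1 - Λ) := by
  rw [← Matrix.vecMul_injective_iff_isUnit, ← Matrix.coe_vecMulLinear,
    ← LinearMap.ker_eq_bot, LinearMap.ker_eq_bot']
  intro x hx
  rw [Matrix.vecMulLinear_apply, Matrix.vecMul_sub, Matrix.vecMul_one, sub_eq_zero] at hx
  have key : ∀ n b, ρ b = n → x b = 0 := by
    intro n
    induction n using Nat.strong_induction_on with
    | _ n ih =>
      intro b hb
      rw [hx]
      refine Finset.sum_eq_zero fun a _ => ?_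
      by_cases h : Λ a b = 0
      · simp [h]
      · rw [ih (ρ a) (hb ▸ hΛ a b h) a rfl, zero_mul]
  ext b
  exact key _ b rfl

lemma pathMatrix_mul (h : IsUnit (1 - Λ)) : pathMatrix Λ * (1 - Λ) = 1 :=
  Matrix.nonsing_inv_mul _ ((Matrix.isUnit_iff_isUnit_det _).1 h)

lemma mul_pathMatrix (h : IsUnit (1 - Λ)) : (1 - Λ) * pathMatrix Λ = 1 :=
  Matrix.mul_nonsing_inv _ ((Matrix.isUnit_iff_isUnit_det _).1 h)

lemma pathMatrix_apply (h : IsUnit (1 - Λ)) (s b : V) :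
    pathMatrix Λ s b = (if s = b then 1 else 0) + ∑ a, pathMatrix Λ s a * Λ a b := by
  have h1 := congrFun (congrFun (pathMatrix_mul h) s) b
  rw [Matrix.mul_sub, Matrix.mul_one, Matrix.sub_apply, Matrix.mul_apply, Matrix.one_apply] at h1
  linarith

lemma eq_sum_mul_pathMatrix (h : IsUnit (1 - Λ)) {x b : V → ℝ}
    (hx : ∀ v, x v = (∑ p, x p * Λ p v) + b v) (v : V) : x v = ∑ s, b s * pathMatrix Λ s v := by
  have h1 : Matrix.vecMul x (1 - Λ) = b := by
    ext v
    rw [Matrix.vecMul_sub, Matrix.vecMul_one, Pi.sub_apply, hx v]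
    simp [Matrix.vecMul, dotProduct]
  have h2 : x = Matrix.vecMul b (pathMatrix Λ) := by
    rw [← h1, Matrix.vecMul_vecMul, mul_pathMatrix h, Matrix.vecMul_one]
  conv_lhs => rw [h2]
  rfl

lemma eq_sum_pathMatrix_mul (h : IsUnit (1 - Λ)) {x b : V → ℝ}
    (hx : ∀ v, x v = (∑ u, Λ v u * x u) + b v) (v : V) : x v = ∑ u, pathMatrix Λ v u * b u := by
  have h1 : Matrix.mulVec (1 - Λ) x = b := by
    ext v
    rw [Matrix.sub_mulVec, Matrix.one_mulVec, Pi.sub_apply, hx v]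
    simp [Matrix.mulVec, dotProduct]
  have h2 : x = Matrix.mulVec (pathMatrix Λ) b := by
    rw [← h1, Matrix.mulVec_mulVec, pathMatrix_mul h, Matrix.one_mulVec]
  conv_lhs => rw [h2]
  rfl

variable {G : Digraph V}

/-- If all directed paths from `s` to `a` contain `c`, then the path matrix factors through `c`. -/
lemma pathMatrix_eq_mul (hρ : ∀ a b, G.Adj a b → ρ a < ρ b) (hΛ : ∀ a b, Λ a b ≠ 0 → G.Adj a b)
    {s c : V} (hcc : pathMatrix Λ c c = 1) (a : V)
    (hp : ∀ p, IsDirectedPath G p s a → c ∈ p) :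
    pathMatrix Λ s a = pathMatrix Λ s c * pathMatrix Λ c a := by
  have hu : IsUnit (1 - Λ) := isUnit_one_sub fun a b h => hρ a b (hΛ a b h)
  have key : ∀ n a, ρ a = n → (∀ p, IsDirectedPath G p s a → c ∈ p) →
      pathMatrix Λ s a = pathMatrix Λ s c * pathMatrix Λ c a := by
    intro n
    induction n using Nat.strong_induction_on with
    | _ n ih =>
      intro a ha hp
      by_cases hca : c = a
      · subst hca; rw [hcc, mul_one]
      have hsa : s ≠ a := by
        rintro rfl
        have := hp _ (isDirectedPath_singleton s)
        simp [hca] at this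
      rw [pathMatrix_apply hu s a, pathMatrix_apply hu c a, if_neg hca, if_neg hsa, zero_add,
        zero_add, Finset.mul_sum]
      refine Finset.sum_congr rfl fun q _ => ?_
      by_cases h : Λ q a = 0
      · simp [h]
      have hqa := hΛ q a h
      rw [ih (ρ q) (ha ▸ hρ q a hqa) q rfl, mul_assoc]
      -- A path to `q` extends along the last edge to `a`; as c ≠ a, the vertex c already lies on
      -- the path to `q`.
      intro p hpq
      have := hp _ (hpq.append_singleton hqa)
      simpa [hca] using this
  exact key _ a rfl hp

lemma exists_isDirectedPath_of_pathMatrix_ne_zero (hρ : ∀ a b, G.Adj a b → ρ a < ρ b)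
    (hΛ : ∀ a b, Λ a b ≠ 0 → G.Adj a b) {s : V} (b : V) (hb : pathMatrix Λ s b ≠ 0) :
    ρ s ≤ ρ b ∧ ∃ p, IsDirectedPath G p s b := by
  have hu : IsUnit (1 - Λ) := isUnit_one_sub fun a b h => hρ a b (hΛ a b h)
  have key : ∀ n b, ρ b = n → pathMatrix Λ s b ≠ 0 →
      ρ s ≤ ρ b ∧ ∃ p, IsDirectedPath G p s b := by
    intro n
    induction n using Nat.strong_induction_on with
    | _ n ih =>
      intro b hbn hb
      by_cases hsb : s = b
      · subst hsb; exact ⟨le_rfl, _, isDirectedPath_singleton s⟩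
      rw [pathMatrix_apply hu, if_neg hsb, zero_add] at hb
      obtain ⟨a, _, ha⟩ := Finset.exists_ne_zero_of_sum_ne_zero hb
      have hab := hΛ a b (right_ne_zero_of_mul ha)
      obtain ⟨h1, p, hp⟩ := ih (ρ a) (hbn ▸ hρ a b hab) a rfl (left_ne_zero_of_mul ha)
      exact ⟨h1.trans (hρ a b hab).le, _, hp.append_singleton hab⟩
  exact key _ b rfl hb

lemma pathMatrix_self (hρ : ∀ a b, G.Adj a b → ρ a < ρ b)
    (hΛ : ∀ a b, Λ a b ≠ 0 → G.Adj a b) (c : V) : pathMatrix Λ c c = 1 := by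
  rw [pathMatrix_apply (isUnit_one_sub fun a b h => hρ a b (hΛ a b h)), if_pos rfl,
    Finset.sum_eq_zero, add_zero]
  intro a _
  by_contra h
  exact ((exists_isDirectedPath_of_pathMatrix_ne_zero hρ hΛ a (left_ne_zero_of_mul h)).1).not_gt
    (hρ _ _ (hΛ a c (right_ne_zero_of_mul h)))

/-- The covariance matrix with regression coefficients `Λ` and error variances `φ`. -/
noncomputable def trekMatrix (Λ : Matrix V V ℝ) (φ : V → ℝ) : Matrix V V ℝ :=
  fun a b => ∑ s, φ s * (pathMatrix Λ s a * pathMatrix Λ s b)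

lemma trekMatrix_comm (Λ : Matrix V V ℝ) (φ : V → ℝ) (a b : V) :
    trekMatrix Λ φ a b = trekMatrix Λ φ b a :=
  Finset.sum_congr rfl fun s _ => by rw [mul_comm (pathMatrix Λ s a)]

lemma trekMatrix_eq_mul (hρ : ∀ a b, G.Adj a b → ρ a < ρ b) (hΛ : ∀ a b, Λ a b ≠ 0 → G.Adj a b)
    (φ : V → ℝ) {A B : Set V} {c : V} (hsep : TSeparates G {c} ∅ A B) {a b : V} (ha : a ∈ A)
    (hb : b ∈ B) : trekMatrix Λ φ a b = pathMatrix Λ c a * trekMatrix Λ φ c b := by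
  rw [trekMatrix, trekMatrix, Finset.mul_sum]
  refine Finset.sum_congr rfl fun s _ => ?_
  -- A source with nonzero entry at `b` has a path to `b`, which turns each path from `s` to `a`
  -- into the left leg of a trek.
  by_cases h : pathMatrix Λ s b = 0
  · simp [h]
  obtain ⟨_, q, hq⟩ := exists_isDirectedPath_of_pathMatrix_ne_zero hρ hΛ b h
  rw [pathMatrix_eq_mul hρ hΛ (pathMatrix_self hρ hΛ c) a]
  · ring
  · intro p hp
    rcases hsep a ha b hb p q ⟨s, hp, hq⟩ with ⟨x, hx, hxp⟩ | ⟨x, hx, _⟩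
    · exact (Set.mem_singleton_iff.1 hx) ▸ hxp
    · exact absurd hx (Set.notMem_empty x)

lemma trekMatrix_tetrad_eq_zero (hρ : ∀ a b, G.Adj a b → ρ a < ρ b)
    (hΛ : ∀ a b, Λ a b ≠ 0 → G.Adj a b) (φ : V → ℝ) {c i j k l : V}
    (hsep : TSeparates G {c} ∅ {i, j} {k, l}) :
    trekMatrix Λ φ i k * trekMatrix Λ φ j l - trekMatrix Λ φ i l * trekMatrix Λ φ j k = 0 := by
  rw [trekMatrix_eq_mul hρ hΛ φ hsep (a := i) (b := k) (by simp) (by simp),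
    trekMatrix_eq_mul hρ hΛ φ hsep (a := j) (b := k) (by simp) (by simp),
    trekMatrix_eq_mul hρ hΛ φ hsep (a := i) (b := l) (by simp) (by simp),
    trekMatrix_eq_mul hρ hΛ φ hsep (a := j) (b := l) (by simp) (by simp)]
  ring

/-- The `2 × 2` minor of `M` with rows `s, t` and columns `i, j`. -/
def minor (M : Matrix V V ℝ) (s t i j : V) : ℝ := M s i * M t j - M s j * M t i

open Polynomial in
/-- Two nonvanishing minors of path matrices can be made nonzero simultaneously. -/
lemma exists_minor_ne_zero {Λ₁ Λ₂ : Matrix V V ℝ} (hρ : ∀ a b, G.Adj a b → ρ a < ρ b)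
    (h₁ : ∀ a b, Λ₁ a b ≠ 0 → G.Adj a b) (h₂ : ∀ a b, Λ₂ a b ≠ 0 → G.Adj a b)
    {s t i j k l : V} (hm₁ : minor (pathMatrix Λ₁) s t i j ≠ 0)
    (hm₂ : minor (pathMatrix Λ₂) s t k l ≠ 0) :
    ∃ Λ : Matrix V V ℝ, (∀ a b, Λ a b ≠ 0 → G.Adj a b) ∧
      minor (pathMatrix Λ) s t i j ≠ 0 ∧ minor (pathMatrix Λ) s t k l ≠ 0 := by
  let L : ℝ → Matrix V V ℝ := fun x => Λ₁ + x • (Λ₂ - Λ₁)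
  have hL : ∀ x a b, L x a b ≠ 0 → G.Adj a b := by
    intro x a b h
    by_contra hab
    have e1 := not_not.1 (mt (h₁ a b) hab)
    have e2 := not_not.1 (mt (h₂ a b) hab)
    simp [L, e1, e2] at h
  -- On the line from Λ₁ to Λ₂ the determinant of 1 - L x never vanishes, so by the adjugate formula
  -- each minor times its square is a polynomial in x, nonzero at x = 0 or at x = 1.
  let A : Matrix V V ℝ[X] := 1 - (Λ₁.map C + (X : ℝ[X]) • (Λ₂ - Λ₁).map C)
  have hA : ∀ x, (evalRingHom x).mapMatrix A = 1 - L x := by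
    intro x
    ext a b
    by_cases hab : a = b <;> simp [A, L, hab]
  have hadj : ∀ x a b, (A.adjugate a b).eval x = (1 - L x).det * pathMatrix (L x) a b := by
    intro x a b
    have h1 := congrFun (congrFun ((evalRingHom x).map_adjugate A) a) b
    rw [hA] at h1
    have hdet := (Matrix.isUnit_iff_isUnit_det _).1
      (isUnit_one_sub (Λ := L x) fun a b h => hρ a b (hL x a b h))
    rw [pathMatrix, Matrix.inv_def, Matrix.smul_apply, smul_eq_mul, ← mul_assoc,
      Ring.mul_inverse_cancel _ hdet, one_mul, ← h1]
    simp
  have hdet : ∀ x, (1 - L x).det ≠ 0 := fun x => ((Matrix.isUnit_iff_isUnit_det _).1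
      (isUnit_one_sub (Λ := L x) fun a b h => hρ a b (hL x a b h))).ne_zero
  let P : V → V → ℝ[X] := fun a b =>
    A.adjugate s a * A.adjugate t b - A.adjugate s b * A.adjugate t a
  have hP : ∀ x a b, (P a b).eval x = (1 - L x).det ^ 2 * minor (pathMatrix (L x)) s t a b := by
    intro x a b
    simp only [P, eval_sub, eval_mul, hadj, minor]
    ring
  have hL0 : L 0 = Λ₁ := by simp [L]
  have hL1 : L 1 = Λ₂ := by simp [L]
  have hP₁ : P i j ≠ 0 := by
    intro h
    have := hP 0 i j
    rw [h, eval_zero, hL0] at this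
    exact mul_ne_zero (pow_ne_zero 2 (hL0 ▸ hdet 0)) hm₁ this.symm
  have hP₂ : P k l ≠ 0 := by
    intro h
    have := hP 1 k l
    rw [h, eval_zero, hL1] at this
    exact mul_ne_zero (pow_ne_zero 2 (hL1 ▸ hdet 1)) hm₂ this.symm
  obtain ⟨x, hx⟩ : ∃ x, (P i j * P k l).eval x ≠ 0 := by
    by_contra! h
    exact mul_ne_zero hP₁ hP₂ (Polynomial.funext fun x => by simpa using h x)
  rw [eval_mul, hP, hP] at hx
  exact ⟨L x, hL x, right_ne_zero_of_mul (left_ne_zero_of_mul hx),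
    right_ne_zero_of_mul (right_ne_zero_of_mul hx)⟩

/-- Positive error variances with a nonzero tetrad. -/
lemma exists_trekMatrix_tetrad_ne_zero {s t i j k l : V}
    (h₁ : minor (pathMatrix Λ) s t i j ≠ 0) (h₂ : minor (pathMatrix Λ) s t k l ≠ 0) :
    ∃ φ : V → ℝ≥0, (∀ v, 0 < φ v) ∧
      trekMatrix Λ (fun v => φ v) i k * trekMatrix Λ (fun v => φ v) j l -
        trekMatrix Λ (fun v => φ v) i l * trekMatrix Λ (fun v => φ v) j k ≠ 0 := by
  -- At x = 0 only s and t carry variance and the tetrad is the product of the two minors; a small x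
  -- > 0 makes all variances positive.
  let φ : ℝ → V → ℝ := fun x v => x + ((if v = s then 1 else 0) + (if v = t then 1 else 0))
  let F : ℝ → ℝ := fun x => trekMatrix Λ (φ x) i k * trekMatrix Λ (φ x) j l -
    trekMatrix Λ (φ x) i l * trekMatrix Λ (φ x) j k
  have hF : Continuous F := by
    simp only [F, φ, trekMatrix]
    fun_prop
  have hF0 : F 0 ≠ 0 := by
    have e : F 0 = minor (pathMatrix Λ) s t i j * minor (pathMatrix Λ) s t k l := by
      simp only [F, φ, trekMatrix, minor, zero_add, add_mul, ite_mul, one_mul, zero_mul,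
        Finset.sum_const_zero,
        Finset.sum_add_distrib, Finset.sum_ite_eq', Finset.mem_univ, if_true]
      ring
    rw [e]
    exact mul_ne_zero h₁ h₂
  have hev : ∀ᶠ x in nhdsWithin (0 : ℝ) (Set.Ioi 0), F x ≠ 0 :=
    (hF.continuousAt.eventually_ne hF0).filter_mono nhdsWithin_le_nhds
  obtain ⟨x, hx, hx0⟩ := (hev.and self_mem_nhdsWithin).exists
  have hpos : ∀ v, 0 < φ x v := by
    intro v
    have : 0 < x := hx0
    simp only [φ]
    positivity
  exact ⟨fun v => ⟨φ x v, (hpos v).le⟩, hpos, hx⟩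

end PathMatrix

/-! ### Consistent covariance matrices are trek matrices -/

section Consistent

open Classical in
/-- The regression coefficients `coef`, set to zero at non-edges. -/
noncomputable def edgeMatrix {V : Type*} (G : Digraph V) (coef : V → V → ℝ) : Matrix V V ℝ :=
  fun a b => if G.Adj a b then coef a b else 0

lemma edgeMatrix_ne_zero {V : Type*} {G : Digraph V} {coef : V → V → ℝ} (a b : V)
    (h : edgeMatrix G coef a b ≠ 0) : G.Adj a b := by
  by_contra hab
  exact h (if_neg hab)

variable {V : Type*} [Fintype V] {G : Digraph V} {coef : V → V → ℝ} {ρ : V → ℕ}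

lemma sum_parents (f : V → ℝ) (j : V) :
    ∑ i ∈ parents G j, coef i j * f i = ∑ i, f i * edgeMatrix G coef i j := by
  classical
  rw [parents, Finset.sum_filter]
  refine Finset.sum_congr rfl fun i _ => ?_
  by_cases h : G.Adj i j <;> simp [edgeMatrix, h, mul_comm]

variable [DecidableEq V]

lemma IsRegressionSystem.covariance_eq (hρ : ∀ a b, G.Adj a b → ρ a < ρ b) {φ : V → ℝ≥0}
    {Ω : Type _} [MeasurableSpace Ω] {P : Measure Ω} [IsProbabilityMeasure P] {X ε : V → Ω → ℝ}
    (h : IsRegressionSystem G coef φ P X ε) (a b : V) :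
    cov[X a, X b; P] = trekMatrix (edgeMatrix G coef) (fun v => φ v) a b := by
  set M := pathMatrix (edgeMatrix G coef) with hM
  have hu : IsUnit (1 - edgeMatrix G coef) :=
    isUnit_one_sub fun a b h => hρ a b (edgeMatrix_ne_zero a b h)
  have hX : ∀ v, X v = fun ω => ∑ s, ε s ω * M s v := by
    intro v
    ext ω
    refine eq_sum_mul_pathMatrix hu (x := fun v => X v ω) (b := fun v => ε v ω) ?_ v
    intro v
    rw [h.regression v ω, sum_parents]
  have hL : ∀ v, MemLp (ε v) 2 P := fun v => by
    have h1 := memLp_id_gaussianReal (μ := 0) (v := φ v) 2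
    have h2 := h.error_law v
    rw [← h2.map_eq] at h1
    exact (memLp_map_measure_iff h1.aestronglyMeasurable h2.aemeasurable).1 h1
  have hcov : ∀ s t, cov[ε s, ε t; P] = if s = t then (φ s : ℝ) else 0 := by
    intro s t
    by_cases hst : s = t
    · subst hst
      rw [if_pos rfl, covariance_self (h.error_law s).aemeasurable, (h.error_law s).variance_eq,
        variance_id_gaussianReal]
    · rw [if_neg hst]
      exact (h.error_indep.indepFun hst).covariance_eq_zero (hL s) (hL t)
  rw [hX a, hX b, covariance_fun_sum_fun_sum (fun s => (hL s).mul_const _)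
    (fun s => (hL s).mul_const _), trekMatrix]
  refine Finset.sum_congr rfl fun s _ => ?_
  simp only [covariance_mul_const_left, covariance_mul_const_right, hcov, ite_mul, zero_mul,
    Finset.sum_ite_eq, Finset.mem_univ, if_true]
  ring

lemma IsConsistent.exists_eq_trekMatrix (hρ : ∀ a b, G.Adj a b → ρ a < ρ b) {S : Matrix V V ℝ}
    (h : IsConsistent G S) :
    ∃ (Λ : Matrix V V ℝ) (φ : V → ℝ), (∀ a b, Λ a b ≠ 0 → G.Adj a b) ∧
      ∀ a b, S a b = trekMatrix Λ φ a b := by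
  obtain ⟨coef, φ, Ω, _, P, X, ε, _, hsys, hS⟩ := h
  exact ⟨edgeMatrix G coef, fun v => φ v, edgeMatrix_ne_zero,
    fun a b => (hS a b).trans (hsys.covariance_eq hρ a b)⟩

lemma isConsistent_trekMatrix (hρ : ∀ a b, G.Adj a b → ρ a < ρ b) {Λ : Matrix V V ℝ}
    (hΛ : ∀ a b, Λ a b ≠ 0 → G.Adj a b) {φ : V → ℝ≥0} (hφ : ∀ v, 0 < φ v) :
    IsConsistent G (trekMatrix Λ fun v => φ v) := by
  have he : edgeMatrix G Λ = Λ := by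
    ext a b
    by_cases h : G.Adj a b
    · exact if_pos h
    · exact (if_neg h).trans (not_not.1 (mt (hΛ a b) h)).symm
  have hu : IsUnit (1 - Λ) := isUnit_one_sub fun a b h => hρ a b (hΛ a b h)
  -- The errors are the coordinates of a product Gaussian space, and X = εM solves the regressions.
  let P : Measure (V → ℝ) := Measure.pi fun v => gaussianReal 0 (φ v)
  let ε : V → (V → ℝ) → ℝ := fun v ω => ω v
  let X : V → (V → ℝ) → ℝ := fun v ω => ∑ s, ε s ω * pathMatrix Λ s v
  have hsys : IsRegressionSystem G Λ φ P X ε := by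
    refine ⟨hφ, fun v =>
      (measurePreserving_eval (fun v => gaussianReal 0 (φ v)) v).hasLaw, ?_, ?_⟩
    · exact iIndepFun_pi (X := fun _ x => x) fun _ => aemeasurable_id
    · intro j ω
      refine Eq.trans ?_ (congrArg (· + ε j ω) (sum_parents (coef := Λ) (fun i => X i ω) j).symm)
      rw [he]
      simp only [X]
      conv_lhs => enter [2, s]; rw [pathMatrix_apply hu s j]
      simp only [mul_add, Finset.sum_add_distrib, mul_ite, mul_one, mul_zero, Finset.sum_ite_eq',
        Finset.mem_univ, if_true, Finset.mul_sum, Finset.sum_mul]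
      rw [Finset.sum_comm, add_comm]
      simp only [mul_assoc]
  refine ⟨Λ, φ, V → ℝ, inferInstance, P, X, ε, inferInstance, hsys, fun a b => ?_⟩
  rw [hsys.covariance_eq hρ, he]

end Consistent

/-! ### Treks as walks in the doubled graph -/

section Doubled

/-- The doubled graph of `G`: reversed edges on the first copy, edges on the second copy, and an
edge from each vertex to its twin. Its walks from the first to the second copy are the treks. -/
inductive Doubled {V : Type*} (G : Digraph V) : V ⊕ V → V ⊕ V → Prop
  | up {p v : V} : G.Adj p v → Doubled G (Sum.inl v) (Sum.inl p)
  | cross (v : V) : Doubled G (Sum.inl v) (Sum.inr v)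
  | down {v u : V} : G.Adj v u → Doubled G (Sum.inr v) (Sum.inr u)

lemma Doubled.exists_rank {V : Type*} {G : Digraph V} {ρ : V → ℕ}
    (hρ : ∀ a b, G.Adj a b → ρ a < ρ b) :
    ∃ rk : V ⊕ V → ℤ, ∀ u v, Doubled G u v → rk v < rk u := by
  -- The + 1 makes crossing edges strictly decreasing where ρ v = 0.
  refine ⟨Sum.elim (fun v => ρ v + 1) (fun v => -(ρ v : ℤ)), ?_⟩
  rintro _ _ (⟨h⟩ | v | ⟨h⟩)
  · have := hρ _ _ h
    simp only [Sum.elim_inl]; omega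
  · simp only [Sum.elim_inl, Sum.elim_inr]; omega
  · have := hρ _ _ h
    simp only [Sum.elim_inr]; omega

variable {V : Type*} {G : Digraph V} {B : Set (V ⊕ V)} {c : V ⊕ V}

lemma reachAvoiding_inr {b : V} (hb : Sum.inr b ∈ B) (p : List V) (s : V)
    (hp : IsDirectedPath G p s b) (hc : ∀ v ∈ p, Sum.inr v ≠ c) :
    ReachAvoiding (Doubled G) B c (Sum.inr s) := by
  induction p generalizing s with
  | nil => simp [IsDirectedPath] at hp
  | cons x p ih =>
    obtain ⟨h1, h2, h3⟩ := hp
    obtain rfl : x = s := by simpa using h2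
    cases p with
    | nil =>
      obtain rfl : x = b := by simpa using h3
      exact .base hb (hc x (by simp))
    | cons y p =>
      rw [List.isChain_cons_cons] at h1
      exact .step (hc x (by simp)) (.down h1.1)
        (ih y ⟨h1.2, rfl, by simpa using h3⟩ fun v hv => hc v (List.mem_cons_of_mem _ hv))

lemma reachAvoiding_inl {a : V} (p : List V) (s : V) (hp : IsDirectedPath G p s a)
    (hc : ∀ v ∈ p, Sum.inl v ≠ c) (hs : ReachAvoiding (Doubled G) B c (Sum.inl s)) :
    ReachAvoiding (Doubled G) B c (Sum.inl a) := by
  induction p generalizing s with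
  | nil => simp [IsDirectedPath] at hp
  | cons x p ih =>
    obtain ⟨h1, h2, h3⟩ := hp
    obtain rfl : x = s := by simpa using h2
    cases p with
    | nil =>
      obtain rfl : x = a := by simpa using h3
      exact hs
    | cons y p =>
      rw [List.isChain_cons_cons] at h1
      exact ih y ⟨h1.2, rfl, by simpa using h3⟩ (fun v hv => hc v (List.mem_cons_of_mem _ hv))
        (.step (hc y (by simp)) (.up h1.1) hs)

/-- Climb the left leg from its sink to the top, cross over, descend the right leg. -/
lemma IsTrek.reachAvoiding {p q : List V} {a b : V} (h : IsTrek G p q a b) (hb : Sum.inr b ∈ B)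
    (hp : ∀ v ∈ p, Sum.inl v ≠ c) (hq : ∀ v ∈ q, Sum.inr v ≠ c) :
    ReachAvoiding (Doubled G) B c (Sum.inl a) := by
  obtain ⟨s, h1, h2⟩ := h
  refine reachAvoiding_inl p s h1 hp (.step (hp s ?_) (.cross s) (reachAvoiding_inr hb q s h2 hq))
  exact List.mem_of_mem_head? h1.2.1

/-- The copy of V containing c decides which side of the separating pair it occupies. -/
lemma exists_tSeparates {i j k l : V}
    (hi : ¬ ReachAvoiding (Doubled G) {Sum.inr k, Sum.inr l} c (Sum.inl i))
    (hj : ¬ ReachAvoiding (Doubled G) {Sum.inr k, Sum.inr l} c (Sum.inl j)) :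
    ∃ v, TSeparates G {v} ∅ {i, j} {k, l} ∨ TSeparates G ∅ {v} {i, j} {k, l} := by
  have key : ∀ a ∈ ({i, j} : Set V), ∀ b ∈ ({k, l} : Set V), ∀ p q, IsTrek G p q a b →
      (∃ v ∈ p, Sum.inl v = c) ∨ ∃ v ∈ q, Sum.inr v = c := by
    intro a ha b hb p q h
    by_contra! hcon
    have hr := h.reachAvoiding (B := {Sum.inr k, Sum.inr l}) (c := c)
      (by rcases hb with rfl | rfl <;> simp) hcon.1 hcon.2
    rcases ha with rfl | rfl
    exacts [hi hr, hj hr]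
  rcases c with v | v
  · refine ⟨v, Or.inl fun a ha b hb p q h => ?_⟩
    simpa using key a ha b hb p q h
  · refine ⟨v, Or.inr fun a ha b hb p q h => ?_⟩
    simpa using key a ha b hb p q h

/-- Cauchy–Binet over ordered pairs, which counts each minor twice. -/
lemma planeDet_sum {ι : Type*} [Fintype ι] (x y : ι → ℝ) (r : ι → ℝ × ℝ) :
    2 * planeDet (∑ s, x s • r s) (∑ s, y s • r s) =
      ∑ s, ∑ t, (x s * y t - y s * x t) * planeDet (r s) (r t) := by
  have key : ∀ x y : ι → ℝ, planeDet (∑ s, x s • r s) (∑ s, y s • r s) =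
      ∑ s, ∑ t, x s * y t * planeDet (r s) (r t) := by
    intro x y
    simp only [planeDet, Prod.fst_sum, Prod.snd_sum, Prod.smul_fst, Prod.smul_snd, smul_eq_mul,
      Finset.sum_mul_sum, ← Finset.sum_sub_distrib]
    refine Finset.sum_congr rfl fun s _ => Finset.sum_congr rfl fun t _ => ?_
    ring
  have h2 := planeDet_swap (∑ s, x s • r s) (∑ s, y s • r s)
  rw [two_mul]
  nth_rewrite 2 [← neg_neg (planeDet _ _)]
  rw [← h2, key, key]
  simp only [sub_mul, Finset.sum_sub_distrib]
  exact (sub_eq_add_neg _ _).symm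

variable [Fintype V] [DecidableEq V]

/-- If no vertex separates, there are two sources with nonvanishing path minors on both sides. -/
lemma exists_tSeparates_or_minor_ne_zero {ρ : V → ℕ} (hρ : ∀ a b, G.Adj a b → ρ a < ρ b)
    (i j : V) {k l : V} (hkl : k ≠ l) :
    (∃ v, TSeparates G {v} ∅ {i, j} {k, l} ∨ TSeparates G ∅ {v} {i, j} {k, l}) ∨
      ∃ (Λ₁ Λ₂ : Matrix V V ℝ) (s t : V), (∀ a b, Λ₁ a b ≠ 0 → G.Adj a b) ∧
        (∀ a b, Λ₂ a b ≠ 0 → G.Adj a b) ∧ minor (pathMatrix Λ₁) s t i j ≠ 0 ∧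
        minor (pathMatrix Λ₂) s t k l ≠ 0 := by
  obtain ⟨rk, hrk⟩ := Doubled.exists_rank hρ
  obtain ⟨w, r, hw, hrk', hrl, hwk, hwl, hr, hind⟩ := exists_generic_weights (b₁ := Sum.inr k)
    (b₂ := Sum.inr l) rk hrk (by simpa using hkl)
  by_cases hdet : planeDet (r (Sum.inl i)) (r (Sum.inl j)) = 0
  · obtain ⟨c, hi, hj⟩ := hind _ _ hdet
    exact Or.inl (exists_tSeparates hi hj)
  right
  let Λ₁ : Matrix V V ℝ := fun p v => w (Sum.inl v) (Sum.inl p)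
  let Λ₂ : Matrix V V ℝ := fun v u => w (Sum.inr v) (Sum.inr u)
  let φ : V → ℝ := fun v => w (Sum.inl v) (Sum.inr v)
  have h₁ : ∀ a b, Λ₁ a b ≠ 0 → G.Adj a b := fun a b h => by
    cases hw _ _ h with | up h => exact h
  have h₂ : ∀ a b, Λ₂ a b ≠ 0 → G.Adj a b := fun a b h => by
    cases hw _ _ h with | down h => exact h
  have hu₁ : IsUnit (1 - Λ₁) := isUnit_one_sub fun a b h => hρ a b (h₁ a b h)
  have hu₂ : IsUnit (1 - Λ₂) := isUnit_one_sub fun a b h => hρ a b (h₂ a b h)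
  have hback : ∀ v u, w (Sum.inr v) (Sum.inl u) = 0 := fun v u => by
    by_contra h
    cases hw _ _ h
  have hcross : ∀ v u, v ≠ u → w (Sum.inl v) (Sum.inr u) = 0 := fun v u hvu => by
    by_contra h
    cases hw _ _ h
    exact hvu rfl
  -- On the second copy r solves (1 - Λ₂) r = (e_k, e_l), so its coordinates are columns k and l of
  -- the path matrix of Λ₂.
  have hrow : ∀ v, r (Sum.inr v) = (∑ u, Λ₂ v u • r (Sum.inr u)) +
      ((if v = k then 1 else 0), (if v = l then 1 else 0)) := by
    intro v
    by_cases hvk : v = k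
    · subst hvk
      simp [Λ₂, hwk, hrk', hkl]
    by_cases hvl : v = l
    · subst hvl
      simp [Λ₂, hwl, hrl, hkl.symm]
    rw [hr _ (by simpa using hvk) (by simpa using hvl), Fintype.sum_sum_type]
    simp [hback, hvk, hvl, Λ₂]
  have hfst : ∀ v, (r (Sum.inr v)).1 = pathMatrix Λ₂ v k := by
    intro v
    rw [eq_sum_pathMatrix_mul hu₂ (x := fun v => (r (Sum.inr v)).1)
      (b := fun v => if v = k then 1 else 0) ?_ v]
    · simp
    · intro v
      have := congrArg Prod.fst (hrow v)
      simpa [Prod.fst_sum] using this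
  have hsnd : ∀ v, (r (Sum.inr v)).2 = pathMatrix Λ₂ v l := by
    intro v
    rw [eq_sum_pathMatrix_mul hu₂ (x := fun v => (r (Sum.inr v)).2)
      (b := fun v => if v = l then 1 else 0) ?_ v]
    · simp
    · intro v
      have := congrArg Prod.snd (hrow v)
      simpa [Prod.snd_sum] using this
  have hcol : ∀ v, r (Sum.inl v) = (∑ p, Λ₁ p v • r (Sum.inl p)) + φ v • r (Sum.inr v) := by
    intro v
    rw [hr _ (by simp) (by simp), Fintype.sum_sum_type]
    congr 1
    refine Finset.sum_eq_single v (fun u _ huv => ?_) (by simp)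
    rw [hcross v u (Ne.symm huv), zero_smul]
  have hexp : ∀ v, r (Sum.inl v) = ∑ s, pathMatrix Λ₁ s v • (φ s • r (Sum.inr s)) := by
    intro v
    ext
    · rw [eq_sum_mul_pathMatrix hu₁ (x := fun v => (r (Sum.inl v)).1)
        (b := fun v => φ v * (r (Sum.inr v)).1) ?_ v]
      · simp [Prod.fst_sum, mul_comm]
      · intro v
        have := congrArg Prod.fst (hcol v)
        simpa [Prod.fst_sum, mul_comm] using this
    · rw [eq_sum_mul_pathMatrix hu₁ (x := fun v => (r (Sum.inl v)).2)
        (b := fun v => φ v * (r (Sum.inr v)).2) ?_ v]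
      · simp [Prod.snd_sum, mul_comm]
      · intro v
        have := congrArg Prod.snd (hcol v)
        simpa [Prod.snd_sum, mul_comm] using this
  have h2 : 2 * planeDet (r (Sum.inl i)) (r (Sum.inl j)) ≠ 0 := mul_ne_zero two_ne_zero hdet
  rw [hexp i, hexp j, planeDet_sum] at h2
  obtain ⟨s, _, hs⟩ := Finset.exists_ne_zero_of_sum_ne_zero h2
  obtain ⟨t, _, ht⟩ := Finset.exists_ne_zero_of_sum_ne_zero hs
  refine ⟨Λ₁, Λ₂, s, t, h₁, h₂, left_ne_zero_of_mul ht, ?_⟩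
  intro hz
  refine right_ne_zero_of_mul ht ?_
  simp only [minor] at hz
  simp only [planeDet, Prod.smul_fst, Prod.smul_snd, smul_eq_mul, hfst, hsnd]
  linear_combination φ s * φ t * hz

end Doubled

end TrekSep

theorem corollary2p10 {V : Type*} [Fintype V] (G : Digraph V) (hG : TrekSep.IsAcyclic G)
    (i j k l : V) :
    (∀ S : Matrix V V ℝ, TrekSep.IsConsistent G S → S i k * S j l - S i l * S j k = 0) ↔
      ∃ c : V, TrekSep.TSeparates G {c} ∅ {i, j} {k, l} ∨
        TrekSep.TSeparates G ∅ {c} {i, j} {k, l} := by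
  classical
  obtain ⟨ρ, hρ⟩ := TrekSep.exists_rank hG
  constructor
  · intro h
    -- The basis vectors need distinct targets; for k = l every right leg ends at k, so (∅, {k})
    -- separates.
    by_cases hkl : k = l
    · subst hkl
      refine ⟨k, Or.inr fun a _ b hb p q ⟨s, _, hq⟩ => Or.inr ⟨k, rfl, ?_⟩⟩
      obtain rfl : b = k := by simpa using hb
      exact List.mem_of_getLast? hq.2.2
    rcases TrekSep.exists_tSeparates_or_minor_ne_zero hρ i j hkl with hsep |
      ⟨Λ₁, Λ₂, s, t, h₁, h₂, hm₁, hm₂⟩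
    · exact hsep
    obtain ⟨Λ, hΛ, hm₁, hm₂⟩ := TrekSep.exists_minor_ne_zero hρ h₁ h₂ hm₁ hm₂
    obtain ⟨φ, hφ, hne⟩ := TrekSep.exists_trekMatrix_tetrad_ne_zero hm₁ hm₂
    exact absurd (h _ (TrekSep.isConsistent_trekMatrix hρ hΛ hφ)) hne
  · rintro ⟨c, hc⟩ S hS
    obtain ⟨Λ, φ, hΛ, hS⟩ := hS.exists_eq_trekMatrix hρ
    simp only [hS]
    rcases hc with hc | hc
    · exact TrekSep.trekMatrix_tetrad_eq_zero hρ hΛ φ hc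
    -- Reversing treks swaps the two sides, and the covariance matrix is symmetric.
    · have := TrekSep.trekMatrix_tetrad_eq_zero hρ hΛ φ hc.symm
      rw [TrekSep.trekMatrix_comm Λ φ i k, TrekSep.trekMatrix_comm Λ φ j l,
        TrekSep.trekMatrix_comm Λ φ i l, TrekSep.trekMatrix_comm Λ φ j k]
      linear_combination this
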